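/- **Corollary 1.6 (Non-degeneracy of the gradient).** Let $n\ge 1$, $\gamma\ge 0$, $0<\lambda\le\Lambda<\infty$ and $\mathfrak m>0$. There is a constant $\mathfrak c>0$, depending only on $n,\gamma,\lambda,\Lambda,\mathfrak m$, such that the following holds. Let $\Omega\subset\mathbb R^n$ be open and bounded, $\tilde\Omega\subset\subset\Omega$, $\beta\in(0,1]$ and $\phi\in C^{1,\beta}(\Omega)$ (with finite $C^{1,\beta}$ norm). Let $f\in L^\infty(\Omega)$ be defined at every point of $\Omega$, with $f\ge\mathfrak m$ in $\Omega$. Let $F:\mathrm{Sym}(n)\to\mathbb R$ be convex with $F(0)=0$ and $$\mathcal M^-_{\lambda,\Lambda}(X-Y)\le F(X)-F(Y)\le \mathcal M^+_{\lambda,\Lambda}(X-Y)\qquad\text{for all } X,Y\in \mathrm{Sym}(n),$$ where $\mathcal M^-_{\lambda,\Lambda}(X)=\lambda\sum_{e_i>0}e_i+\Lambda\sum_{e_i<0}e_i$ and $\mathcal M^+_{\lambda,\Lambda}(X)=\Lambda\sum_{e_i>0}e_i+\lambda\sum_{e_i<0}e_i$, the $e_i$ being the eigenvalues of $X$. Let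 $u:\Omega\to\mathbb R$ be a bounded continuous function with $$u\ge\phi\ \text{ in }\Omega,\qquad |Du|^\gamma F(D^2u)\le f\ \text{ in }\Omega,\qquad |Du|^\gamma F(D^2u)=f\ \text{ in }\{u>\phi\}:=\{x\in\Omega: u(x)>\phi(x)\},$$ the last two in the viscosity sense. That is, for an open set $U\subset\Omega$, "$|Du|^\gamma F(D^2u)\le f$ in $U$" means that $|D\psi(x)|^\gamma F(D^2\psi(x))\le f(x)$ for all $\psi\in C^2(U)$ and $x\in U$ such that $u-\psi$ has a strict local minimum at $x$; "$\ge$" is defined with the inequality reversed and a strict local maximum at $x$; "$=$" means both. For $\gamma=0$ the factor $|D\psi|^\gamma$ is $1$. No condition is imposed on the boundary values of $u$. If $x_0\in\{u>\phi\}\cap\tilde\Omega$ and $r:=\mathrm{dist}(x_0,\partial\{u>\phi\})$, where $\partial$ is the boundary in $\mathbb R^n$, then $$\sup_{B_r(x_0)}|Du|\ \ge\ \mathfrak c\, r^{\frac1{\gamma+1}}-\tfrac12\|D\phi\|_{L^\infty(B_r(x_0))} .$$ Here $|Du(x)|:=\limsup_{y\to x}\frac{|u(y)-u(x)|}{|y-x|}\in[0,\infty]$,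 which is the norm of the gradient at every point where $u$ is differentiable, and the supremum may be $+\infty$. -/

import Mathlib

open MeasureTheory Topology Filter
open scoped ENNReal NNReal

noncomputable section

namespace ObstacleProblem

/-- Pucci's minimal operator: `lam` times the sum of the positive eigenvalues plus `Lam` times the
sum of the negative ones. For real matrices "Hermitian" means "symmetric". -/
def pucciMin {n : ℕ} (lam Lam : ℝ) (X : Matrix (Fin n) (Fin n) ℝ) (hX : X.IsHermitian) : ℝ :=
  ∑ i, if 0 < hX.eigenvalues i then lam * hX.eigenvalues i else Lam * hX.eigenvalues i

/-- Pucci's maximal operator: `Lam` times the sum of the positive eigenvalues plus `lam` times the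
sum of the negative ones. -/
def pucciMax {n : ℕ} (lam Lam : ℝ) (X : Matrix (Fin n) (Fin n) ℝ) (hX : X.IsHermitian) : ℝ :=
  ∑ i, if 0 < hX.eigenvalues i then Lam * hX.eigenvalues i else lam * hX.eigenvalues i

/-- The standing assumptions on the operator `F : Sym(n) → ℝ`: convexity, uniform ellipticity with
constants `lam ≤ Lam`, and the normalization `F 0 = 0`. Only the values of `F` at symmetric
matrices matter. -/
structure IsConvexElliptic {n : ℕ} (lam Lam : ℝ) (F : Matrix (Fin n) (Fin n) ℝ → ℝ) : Prop where
  convex : ConvexOn ℝ {X : Matrix (Fin n) (Fin n) ℝ | X.IsHermitian} F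
  lower : ∀ (X Y : Matrix (Fin n) (Fin n) ℝ) (hX : X.IsHermitian) (hY : Y.IsHermitian),
    pucciMin lam Lam (X - Y) (hX.sub hY) ≤ F X - F Y
  upper : ∀ (X Y : Matrix (Fin n) (Fin n) ℝ) (hX : X.IsHermitian) (hY : Y.IsHermitian),
    F X - F Y ≤ pucciMax lam Lam (X - Y) (hX.sub hY)
  zero : F 0 = 0

/-- The Hessian matrix `D²ψ(x)`. -/
def hessian {n : ℕ} (ψ : EuclideanSpace ℝ (Fin n) → ℝ) (x : EuclideanSpace ℝ (Fin n)) :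
    Matrix (Fin n) (Fin n) ℝ :=
  Matrix.of fun i j =>
    fderiv ℝ (fderiv ℝ ψ) x (EuclideanSpace.single i 1) (EuclideanSpace.single j 1)

/-- The degenerate operator `|Dψ(x)|^γ F(D²ψ(x))` on a smooth function `ψ`. -/
def degOp {n : ℕ} (γ : ℝ) (F : Matrix (Fin n) (Fin n) ℝ → ℝ)
    (ψ : EuclideanSpace ℝ (Fin n) → ℝ) (x : EuclideanSpace ℝ (Fin n)) : ℝ :=
  ‖gradient ψ x‖ ^ γ * F (hessian ψ x)

/-- `u` is a viscosity super-solution of `|Du|^γ F(D²u) = f` in the open set `U`, that is,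
`|Du|^γ F(D²u) ≤ f` in the viscosity sense: the inequality holds for every `C²` test function `ψ`
at every point of `U` where `u - ψ` has a strict (local) minimum. -/
def IsViscositySuper {n : ℕ} (γ : ℝ) (F : Matrix (Fin n) (Fin n) ℝ → ℝ)
    (f : EuclideanSpace ℝ (Fin n) → ℝ) (U : Set (EuclideanSpace ℝ (Fin n)))
    (u : EuclideanSpace ℝ (Fin n) → ℝ) : Prop :=
  ContinuousOn u U ∧ ∀ ψ : EuclideanSpace ℝ (Fin n) → ℝ, ContDiffOn ℝ 2 ψ U → ∀ x ∈ U,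
    (∀ᶠ y in 𝓝[≠] x, u x - ψ x < u y - ψ y) → degOp γ F ψ x ≤ f x

/-- `u` is a viscosity sub-solution of `|Du|^γ F(D²u) = f` in the open set `U`, that is,
`|Du|^γ F(D²u) ≥ f` in the viscosity sense: the inequality holds for every `C²` test function `ψ`
at every point of `U` where `u - ψ` has a strict (local) maximum. -/
def IsViscositySub {n : ℕ} (γ : ℝ) (F : Matrix (Fin n) (Fin n) ℝ → ℝ)
    (f : EuclideanSpace ℝ (Fin n) → ℝ) (U : Set (EuclideanSpace ℝ (Fin n)))
    (u : EuclideanSpace ℝ (Fin n) → ℝ) : Prop :=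
  ContinuousOn u U ∧ ∀ ψ : EuclideanSpace ℝ (Fin n) → ℝ, ContDiffOn ℝ 2 ψ U → ∀ x ∈ U,
    (∀ᶠ y in 𝓝[≠] x, u y - ψ y < u x - ψ x) → f x ≤ degOp γ F ψ x

/-- Viscosity solutions are the functions that are both super- and sub-solutions. -/
def IsViscositySolution {n : ℕ} (γ : ℝ) (F : Matrix (Fin n) (Fin n) ℝ → ℝ)
    (f : EuclideanSpace ℝ (Fin n) → ℝ) (U : Set (EuclideanSpace ℝ (Fin n)))
    (u : EuclideanSpace ℝ (Fin n) → ℝ) : Prop :=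
  IsViscositySuper γ F f U u ∧ IsViscositySub γ F f U u

/-- The non-coincidence set `{u > φ}`, a subset of `Ω`. -/
def nonCoincidence {n : ℕ} (Ω : Set (EuclideanSpace ℝ (Fin n)))
    (φ u : EuclideanSpace ℝ (Fin n) → ℝ) : Set (EuclideanSpace ℝ (Fin n)) :=
  {x ∈ Ω | φ x < u x}

/-- `u` is a viscosity solution of the `(F, γ)`-obstacle problem in `Ω` with obstacle `φ` and
source term `f`:  `u ≥ φ` in `Ω`,  `|Du|^γ F(D²u) ≤ f` in `Ω`,  `|Du|^γ F(D²u) = f` in `{u > φ}`.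
No boundary values are prescribed, so solutions with any boundary datum `u = g` on `∂Ω` are
covered. -/
structure IsObstacleSolution {n : ℕ} (γ : ℝ) (F : Matrix (Fin n) (Fin n) ℝ → ℝ)
    (f φ : EuclideanSpace ℝ (Fin n) → ℝ) (Ω : Set (EuclideanSpace ℝ (Fin n)))
    (u : EuclideanSpace ℝ (Fin n) → ℝ) : Prop where
  above : ∀ x ∈ Ω, φ x ≤ u x
  super : IsViscositySuper γ F f Ω u
  solution : IsViscositySolution γ F f (nonCoincidence Ω φ u) u

/-- The Hölder class `C^{1,β}(Ω)`, functions with finite `C^{1,β}` norm. -/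
structure IsC1Holder {n : ℕ} (β : ℝ≥0) (Ω : Set (EuclideanSpace ℝ (Fin n)))
    (φ : EuclideanSpace ℝ (Fin n) → ℝ) : Prop where
  contDiffOn : ContDiffOn ℝ 1 φ Ω
  bounded : ∃ M : ℝ, ∀ x ∈ Ω, |φ x| ≤ M ∧ ‖gradient φ x‖ ≤ M
  holder : ∃ C : ℝ≥0, HolderOnWith C β (gradient φ) Ω

/-- The length `|Du(x)| ∈ [0, ∞]` of the gradient of a function that need not be differentiable:
`limsup_{y → x} |u y - u x| / |y - x|`. It is the norm of the gradient wherever `u` is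
differentiable, see `gradLength_eq`; unlike `‖gradient u x‖` it has no default value elsewhere. -/
def gradLength {n : ℕ} (u : EuclideanSpace ℝ (Fin n) → ℝ) (x : EuclideanSpace ℝ (Fin n)) : ℝ≥0∞ :=
  limsup (fun y => edist (u y) (u x) / edist y x) (𝓝[≠] x)

theorem gradLength_eq {n : ℕ} {u : EuclideanSpace ℝ (Fin n) → ℝ} {x : EuclideanSpace ℝ (Fin n)}
    (hu : DifferentiableAt ℝ u x) : gradLength u x = ‖gradient u x‖ₑ := by
  have hL : ‖gradient u x‖ₑ = ‖fderiv ℝ u x‖ₑ := by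
    rw [← ofReal_norm, ← ofReal_norm, gradient, LinearIsometryEquiv.norm_map]
  have key : ∀ b : ℝ≥0, ∀ y : EuclideanSpace ℝ (Fin n), y ≠ x →
      (edist (u y) (u x) / edist y x ≤ b ↔ ‖u y - u x‖ ≤ b * ‖y - x‖) := by
    intro b y hy
    rw [ENNReal.div_le_iff (by simpa [edist_eq_zero] using hy) (edist_ne_top _ _),
      edist_nndist, edist_nndist, ← ENNReal.coe_mul, ENNReal.coe_le_coe, ← NNReal.coe_le_coe]
    push_cast
    rw [dist_eq_norm, dist_eq_norm]
  rw [hL]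
  apply le_antisymm
  · apply ENNReal.le_of_forall_pos_le_add
    intro ε hε _
    refine limsup_le_of_le (by isBoundedDefault) ?_
    have h := hu.hasFDerivAt.isLittleO.def (show (0 : ℝ) < ε from hε)
    rw [eventually_nhdsWithin_iff]
    filter_upwards [h] with y hy hyx
    have : (‖fderiv ℝ u x‖ₑ + (ε : ℝ≥0∞)) = ((‖fderiv ℝ u x‖₊ + ε : ℝ≥0) : ℝ≥0∞) := by
      push_cast; rfl
    rw [this, key _ _ hyx]
    have h1 := (fderiv ℝ u x).le_opNorm (y - x)
    have h2 := norm_add_le (u y - u x - fderiv ℝ u x (y - x)) (fderiv ℝ u x (y - x))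
    rw [sub_add_cancel] at h2
    push_cast
    rw [add_mul]
    linarith
  · refine le_of_forall_gt fun a ha => ?_
    by_contra hcon
    obtain ⟨b, hb1, hb2⟩ := ENNReal.lt_iff_exists_nnreal_btwn.1 (lt_of_lt_of_le ha (not_lt.1 hcon))
    have hev := eventually_lt_of_limsup_lt hb1
    rw [eventually_nhdsWithin_iff] at hev
    have := hu.hasFDerivAt.le_of_lip' b.2 (by
      filter_upwards [hev] with y hy
      by_cases hyx : y = x
      · simp [hyx]
      · exact (key b y hyx).1 (hy hyx).le)
    apply absurd hb2
    rw [not_lt]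
    change ((‖fderiv ℝ u x‖₊ : ℝ≥0) : ℝ≥0∞) ≤ b
    exact_mod_cast this

end ObstacleProblem

end

/-! A strict subsolution bound forces quadratic-type growth, and growth forces a large gradient. On
the closed ball of radius `s` about `x₀`, compare `u` with `A / 2 * ‖y - x₀‖ ^ 2`, where `A` is so
small that the operator stays below `m` on paraboloids of this size. An interior maximum of the
difference would contradict the subsolution property, so the maximum lies on the sphere, and `u`
rises by at least `A / 2 * s ^ 2` over a distance `s` (`exists_sphere_le_sub`). If `gradLength u` is
below `L` on the ball, then `u` is `L`-Lipschitz there (`sub_le_mul_norm_of_gradLength_lt`), hence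
`L ≥ A * s / 2`. Balancing `(A * s) ^ γ * A` against `m` makes `A * s` comparable to `r ^ (1 / (γ +
1))`.

Only the subsolution property in the non-coincidence set enters; the obstacle term merely weakens
the bound. -/

theorem hasFDerivAt_half_mul_norm_sub_sq {E : Type*} [NormedAddCommGroup E]
    [InnerProductSpace ℝ E] (A : ℝ) (a y : E) :
    HasFDerivAt (fun y => A / 2 * ‖y - a‖ ^ 2) (A • innerSL ℝ (y - a)) y := by
  have h := (((hasFDerivAt_id (𝕜 := ℝ) y).sub_const a).norm_sq).const_mul (A / 2)
  refine h.congr_fderiv ?_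
  ext v
  simp
  ring

/-- A sum of two paraboloids of equal opening. -/
noncomputable def paraboloidSum {n : ℕ} (A : ℝ) (a b y : EuclideanSpace ℝ (Fin n)) : ℝ :=
  A / 2 * ‖y - a‖ ^ 2 + A / 2 * ‖y - b‖ ^ 2

theorem contDiff_paraboloidSum {n : ℕ} (A : ℝ) (a b : EuclideanSpace ℝ (Fin n)) :
    ContDiff ℝ 2 (paraboloidSum A a b) := by
  unfold paraboloidSum
  exact (contDiff_const.mul ((contDiff_id.sub contDiff_const).norm_sq ℝ)).add
    (contDiff_const.mul ((contDiff_id.sub contDiff_const).norm_sq ℝ))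

theorem fderiv_paraboloidSum {n : ℕ} (A : ℝ) (a b : EuclideanSpace ℝ (Fin n)) :
    fderiv ℝ (paraboloidSum A a b) =
      fun y => A • innerSL ℝ (y - a) + A • innerSL ℝ (y - b) := by
  ext1 y
  exact ((hasFDerivAt_half_mul_norm_sub_sq A a y).add
    (hasFDerivAt_half_mul_norm_sub_sq A b y)).fderiv

/-- The paraboloid centred at `b` is critical there, so adding it leaves the gradient at `b`
unchanged. -/
theorem norm_gradient_paraboloidSum_right {n : ℕ} {A : ℝ} (hA : 0 ≤ A)
    (a b : EuclideanSpace ℝ (Fin n)) :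
    ‖gradient (paraboloidSum A a b) b‖ = A * ‖b - a‖ := by
  rw [gradient, LinearIsometryEquiv.norm_map, fderiv_paraboloidSum]
  beta_reduce
  rw [sub_self, map_zero, smul_zero, add_zero, norm_smul, innerSL_apply_norm, Real.norm_eq_abs,
    abs_of_nonneg hA]

theorem hessian_paraboloidSum {n : ℕ} (A : ℝ) (a b x : EuclideanSpace ℝ (Fin n)) :
    ObstacleProblem.hessian (paraboloidSum A a b) x =
      (2 * A) • (1 : Matrix (Fin n) (Fin n) ℝ) := by
  have h : HasFDerivAt (fun y : EuclideanSpace ℝ (Fin n) =>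
      A • innerSL ℝ (y - a) + A • innerSL ℝ (y - b))
      (A • (innerSL ℝ) + A • (innerSL ℝ)) x := by
    have h1 (a : EuclideanSpace ℝ (Fin n)) :
        HasFDerivAt (fun y : EuclideanSpace ℝ (Fin n) => innerSL ℝ (y - a)) (innerSL ℝ) x := by
      have h2 := ((innerSL ℝ (E := EuclideanSpace ℝ (Fin n))).hasFDerivAt (x := x)).sub_const
        (innerSL ℝ a)
      simpa only [map_sub] using h2
    exact ((h1 a).const_smul A).add ((h1 b).const_smul A)
  ext i j
  rw [ObstacleProblem.hessian, Matrix.of_apply, fderiv_paraboloidSum, h.fderiv]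
  change A * inner ℝ (EuclideanSpace.single i (1 : ℝ)) (EuclideanSpace.single j (1 : ℝ)) +
    A * inner ℝ (EuclideanSpace.single i (1 : ℝ)) (EuclideanSpace.single j (1 : ℝ)) = _
  rw [EuclideanSpace.inner_single_left]
  by_cases hij : i = j
  · subst hij
    simp
    ring
  · simp [hij]

/-- On a positive semidefinite matrix the maximal Pucci operator is `Lam` times the trace; compare
with `F 0 = 0`. -/
theorem ObstacleProblem.IsConvexElliptic.smul_one_le {n : ℕ} {lam Lam : ℝ}
    {F : Matrix (Fin n) (Fin n) ℝ → ℝ} (hF : ObstacleProblem.IsConvexElliptic lam Lam F)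
    {t : ℝ} (ht : 0 ≤ t) : F (t • (1 : Matrix (Fin n) (Fin n) ℝ)) ≤ Lam * (n * t) := by
  have hpos : (t • (1 : Matrix (Fin n) (Fin n) ℝ) - 0).PosSemidef := by
    rw [sub_zero]
    exact Matrix.PosSemidef.one.smul ht
  have hX : (t • (1 : Matrix (Fin n) (Fin n) ℝ)).IsHermitian := by
    rw [← sub_zero (t • _)]
    exact hpos.isHermitian
  have h := hF.upper _ 0 hX Matrix.isHermitian_zero
  rw [hF.zero, sub_zero] at h
  refine h.trans_eq ?_
  have htr := hpos.isHermitian.trace_eq_sum_eigenvalues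
  have htr' : ∑ i, hpos.isHermitian.eigenvalues i = n * t := by
    simpa [Matrix.trace_smul, mul_comm] using htr.symm
  rw [← htr', Finset.mul_sum]
  refine Finset.sum_congr rfl fun i _ => ?_
  split_ifs with hi
  · rfl
  · have : hpos.isHermitian.eigenvalues i = 0 :=
      le_antisymm (not_lt.1 hi) (hpos.eigenvalues_nonneg i)
    rw [this, mul_zero, mul_zero]

theorem eventually_le_mul_norm_of_gradLength_lt {n : ℕ} {u : EuclideanSpace ℝ (Fin n) → ℝ}
    {x : EuclideanSpace ℝ (Fin n)} {L : ℝ≥0} (h : ObstacleProblem.gradLength u x < L) :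
    ∀ᶠ y in 𝓝 x, |u y - u x| ≤ L * ‖y - x‖ := by
  have hev := eventually_lt_of_limsup_lt h
  rw [eventually_nhdsWithin_iff] at hev
  filter_upwards [hev] with y hy
  by_cases hyx : y = x
  · simp [hyx]
  have hy' := (hy hyx).le
  rw [ENNReal.div_le_iff (by simpa [edist_eq_zero] using hyx) (edist_ne_top _ _),
    edist_nndist, edist_nndist, ← ENNReal.coe_mul, ENNReal.coe_le_coe, ← NNReal.coe_le_coe] at hy'
  push_cast at hy'
  rwa [dist_eq_norm, dist_eq_norm, Real.norm_eq_abs] at hy'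

/-- A mean value inequality without differentiability: along the segment the right slopes of `u` are
eventually at most `L * ‖y - x‖`, which suffices for a continuous function. -/
theorem sub_le_mul_norm_of_gradLength_lt {n : ℕ} {u : EuclideanSpace ℝ (Fin n) → ℝ}
    {s : Set (EuclideanSpace ℝ (Fin n))} (hs : Convex ℝ s) (hu : ContinuousOn u s) {L : ℝ≥0}
    (h : ∀ x ∈ s, ObstacleProblem.gradLength u x < L) {x y : EuclideanSpace ℝ (Fin n)}
    (hx : x ∈ s) (hy : y ∈ s) : u y - u x ≤ L * ‖y - x‖ := by
  have hmem : ∀ t ∈ Set.Icc (0 : ℝ) 1, AffineMap.lineMap x y t ∈ s := fun t ht =>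
    hs.lineMap_mem hx hy ht
  have hline (t z : ℝ) : (AffineMap.lineMap x y z : EuclideanSpace ℝ (Fin n)) -
      AffineMap.lineMap x y t = (z - t) • (y - x) := by
    simp only [AffineMap.lineMap_apply_module']
    module
  have hcl : Continuous fun t : ℝ => (AffineMap.lineMap x y t : EuclideanSpace ℝ (Fin n)) :=
    AffineMap.lineMap_continuous
  have key := image_le_of_liminf_slope_right_le_deriv_boundary
    (f := fun t : ℝ => u (AffineMap.lineMap x y t) - u x)
    (a := 0) (b := 1) (B := fun t => L * ‖y - x‖ * t) (B' := fun _ => L * ‖y - x‖)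
    ((hu.comp hcl.continuousOn hmem).sub continuousOn_const) (by simp) (by fun_prop)
    (fun t _ => by simpa using ((hasDerivWithinAt_id t _).const_mul (L * ‖y - x‖)))
    (fun t ht r hr => by
      refine Eventually.frequently ?_
      have hev := hcl.continuousAt.eventually (eventually_le_mul_norm_of_gradLength_lt
        (h _ (hmem t (Set.Ico_subset_Icc_self ht))))
      filter_upwards [hev.filter_mono nhdsWithin_le_nhds, self_mem_nhdsWithin] with z hz hzt
      have hzt' : 0 < z - t := sub_pos.2 hzt
      rw [hline, norm_smul, Real.norm_eq_abs, abs_of_pos hzt'] at hz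
      rw [slope_def_field, div_lt_iff₀ hzt']
      calc _ ≤ |u (AffineMap.lineMap x y z) - u (AffineMap.lineMap x y t)| := by
            rw [sub_sub_sub_cancel_right]
            exact le_abs_self _
        _ ≤ L * ‖y - x‖ * (z - t) := by linarith
        _ < r * (z - t) := by gcongr)
  simpa using key (Set.right_mem_Icc.2 zero_le_one)

/-- The ball is connected and misses the frontier, so it cannot leave the interior of `U`. If the
distance is `0`, which includes the default value for an empty frontier, the ball is empty. -/
theorem Metric.ball_infDist_frontier_subset {E : Type*} [NormedAddCommGroup E] [NormedSpace ℝ E]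
    {U : Set E} {x : E} (hx : x ∈ U) :
    Metric.ball x (Metric.infDist x (frontier U)) ⊆ U := by
  rcases (Metric.infDist_nonneg (x := x) (s := frontier U)).eq_or_lt with h0 | h0
  · simp [← h0]
  have hf : ∀ y ∈ Metric.ball x (Metric.infDist x (frontier U)), y ∉ frontier U := fun y hy hyf =>
    (Metric.infDist_le_dist_of_mem hyf).not_gt (by rwa [dist_comm])
  refine Set.Subset.trans ?_ (interior_subset (s := U))
  refine (convex_ball x _).isPreconnected.subset_left_of_subset_union isOpen_interior
    (isClosed_closure (s := U)).isOpen_compl ?_ ?_ ?_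
  · exact (disjoint_compl_right (a := closure U)).mono_left
      (interior_subset.trans subset_closure)
  · intro y hy
    by_cases hyc : y ∈ closure U
    · exact Or.inl (by_contra fun hyi => hf y hy ⟨hyc, hyi⟩)
    · exact Or.inr hyc
  · have hxb := Metric.mem_ball_self (x := x) h0
    exact ⟨x, hxb, by_contra fun hxi => hf x hxb ⟨subset_closure hx, hxi⟩⟩

theorem ObstacleProblem.IsViscositySub.exists_sphere_le_sub {n : ℕ}
    {γ lam Lam m A s : ℝ} (hγ : 0 ≤ γ) (hLam : 0 < Lam)
    {F : Matrix (Fin n) (Fin n) ℝ → ℝ} (hF : ObstacleProblem.IsConvexElliptic lam Lam F)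
    {f u : EuclideanSpace ℝ (Fin n) → ℝ} {U : Set (EuclideanSpace ℝ (Fin n))}
    (hf : ∀ x ∈ U, m ≤ f x) (hu : ObstacleProblem.IsViscositySub γ F f U u)
    {x₀ : EuclideanSpace ℝ (Fin n)} (hs : 0 < s) (hU : Metric.closedBall x₀ s ⊆ U)
    (hA : 0 < A) (hAm : (A * s) ^ γ * (Lam * (n * (2 * A))) < m) :
    ∃ x ∈ Metric.sphere x₀ s, A / 2 * s ^ 2 ≤ u x - u x₀ := by
  have hcont : ContinuousOn (fun y => u y - A / 2 * ‖y - x₀‖ ^ 2) (Metric.closedBall x₀ s) :=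
    (hu.1.mono hU).sub (by fun_prop)
  obtain ⟨x, hx, hmax⟩ := (isCompact_closedBall x₀ s).exists_isMaxOn
    ⟨x₀, Metric.mem_closedBall_self hs.le⟩ hcont
  have hx' : ‖x - x₀‖ ≤ s := by simpa [dist_eq_norm] using hx
  rcases hx'.eq_or_lt with hxs | hxs
  · refine ⟨x, by simpa [dist_eq_norm] using hxs, ?_⟩
    have := hmax (Metric.mem_closedBall_self hs.le)
    simp only [Set.mem_ofPred_eq, sub_self, norm_zero, hxs] at this
    linarith
  exfalso
  have hball : ∀ᶠ y in 𝓝 x, y ∈ Metric.closedBall x₀ s := by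
    filter_upwards [Metric.isOpen_ball.mem_nhds
      (show x ∈ Metric.ball x₀ s by simpa [dist_eq_norm] using hxs)] with y hy
    exact Metric.ball_subset_closedBall hy
  -- The maximum at `x` need not be strict. The extra paraboloid centred at `x` makes it so; it adds
  -- nothing to the gradient at `x` and only doubles the Hessian, whence the `2 * A` in `hAm`.
  have htest := hu.2 (paraboloidSum A x₀ x) (contDiff_paraboloidSum A x₀ x).contDiffOn x (hU hx)
    (by
      rw [eventually_nhdsWithin_iff]
      filter_upwards [hball] with y hy hyx
      have h1 : u y - A / 2 * ‖y - x₀‖ ^ 2 ≤ u x - A / 2 * ‖x - x₀‖ ^ 2 := hmax hy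
      have h2 : 0 < ‖y - x‖ := norm_pos_iff.2 (sub_ne_zero.2 hyx)
      have h3 : 0 < A / 2 * ‖y - x‖ ^ 2 := by positivity
      simp only [paraboloidSum, sub_self, norm_zero]
      linarith)
  refine absurd ((hf x (hU hx)).trans htest) (not_le.2 (lt_of_le_of_lt ?_ hAm))
  rw [ObstacleProblem.degOp, norm_gradient_paraboloidSum_right hA.le, hessian_paraboloidSum]
  exact mul_le_mul_of_nonneg (Real.rpow_le_rpow (by positivity) (by gcongr) hγ)
    (hF.smul_one_le (by positivity)) (by positivity) (by positivity)

theorem ObstacleProblem.IsViscositySub.rpow_le_iSup_gradLength {n : ℕ} (hn : 0 < n)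
    {γ lam Lam m r : ℝ} (hγ : 0 ≤ γ) (hLam : 0 < Lam) (hm : 0 < m)
    {F : Matrix (Fin n) (Fin n) ℝ → ℝ} (hF : ObstacleProblem.IsConvexElliptic lam Lam F)
    {f u : EuclideanSpace ℝ (Fin n) → ℝ} {U : Set (EuclideanSpace ℝ (Fin n))}
    (hf : ∀ x ∈ U, m ≤ f x) (hu : ObstacleProblem.IsViscositySub γ F f U u)
    {x₀ : EuclideanSpace ℝ (Fin n)} (hr : 0 < r) (hU : Metric.ball x₀ r ⊆ U) :
    ENNReal.ofReal ((m / (8 * Lam * n)) ^ (1 / (γ + 1)) / 2 * r ^ (1 / (γ + 1)))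
      ≤ ⨆ x ∈ Metric.ball x₀ r, ObstacleProblem.gradLength u x := by
  have hn' : (0 : ℝ) < n := Nat.cast_pos.2 hn
  have hK : 0 < m / (8 * Lam * n) := by positivity
  rw [div_mul_eq_mul_div, ← Real.mul_rpow hK.le hr.le]
  -- `B` is the slope `A * s` of the comparison paraboloid on the sphere.
  set B : ℝ := (m / (8 * Lam * n) * r) ^ (1 / (γ + 1)) with hB
  have hB0 : 0 < B := by positivity
  have hBpow : B ^ γ * B = m / (8 * Lam * n) * r := by
    rw [← Real.rpow_add_one hB0.ne', hB, ← Real.rpow_mul (by positivity),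
      one_div_mul_cancel (by positivity), Real.rpow_one]
  have hball : Metric.closedBall x₀ (r / 2) ⊆ Metric.ball x₀ r :=
    Metric.closedBall_subset_ball (half_lt_self hr)
  by_contra! hlt
  obtain ⟨L, hL, hLB⟩ := ENNReal.lt_iff_exists_nnreal_btwn.1 hlt
  have hLB' : (L : ℝ) < B / 2 := by
    rwa [← ENNReal.ofReal_coe_nnreal, ENNReal.ofReal_lt_ofReal_iff (by positivity)] at hLB
  -- Half the radius keeps the closed ball inside `U`. With `A * s = B`, the constant `8` makes the
  -- operator bound equal to `m / 2`, strictly below `m`.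
  obtain ⟨x, hx, hux⟩ := hu.exists_sphere_le_sub (A := 2 * B / r) (s := r / 2) (m := m) hγ hLam hF hf
    (half_pos hr) (hball.trans hU) (by positivity) (by
      have h1 : 2 * B / r * (r / 2) = B := by field_simp
      have h2 : B ^ γ * (Lam * (n * (2 * (2 * B / r)))) = 4 * Lam * n / r * (B ^ γ * B) := by
        ring
      have h3 : 4 * Lam * n / r * (m / (8 * Lam * n) * r) = m / 2 := by
        field_simp
        norm_num
      rw [h1, h2, hBpow, h3]
      exact half_lt_self hm)
  have hlip := sub_le_mul_norm_of_gradLength_lt (convex_ball x₀ r) (hu.1.mono hU)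
    (fun y hy => (le_iSup₂ (f := fun y _ => ObstacleProblem.gradLength u y) y hy).trans_lt hL)
    (Metric.mem_ball_self hr) (hball (Metric.sphere_subset_closedBall hx))
  rw [mem_sphere_iff_norm.1 hx] at hlip
  have h4 : 2 * B / r / 2 * (r / 2) ^ 2 = B / 2 * (r / 2) := by
    field_simp
  have h5 : (L : ℝ) * (r / 2) < B / 2 * (r / 2) := by gcongr
  linarith

theorem corollary1p6 (n : ℕ) (hn : 0 < n) (γ lam Lam m : ℝ) (hγ : 0 ≤ γ)
    (hlam : 0 < lam) (hLam : lam ≤ Lam) (hm : 0 < m) :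
    ∃ c : ℝ, 0 < c ∧
      ∀ Ω Ω' : Set (EuclideanSpace ℝ (Fin n)), IsOpen Ω → Bornology.IsBounded Ω →
      IsCompact (closure Ω') → closure Ω' ⊆ Ω →
      ∀ F : Matrix (Fin n) (Fin n) ℝ → ℝ, ObstacleProblem.IsConvexElliptic lam Lam F →
      ∀ (β : ℝ≥0) (φ : EuclideanSpace ℝ (Fin n) → ℝ), 0 < β → β ≤ 1 →
      ObstacleProblem.IsC1Holder β Ω φ →
      ∀ f : EuclideanSpace ℝ (Fin n) → ℝ, MemLp f ∞ (volume.restrict Ω) → (∀ x ∈ Ω, m ≤ f x) →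
      ∀ u : EuclideanSpace ℝ (Fin n) → ℝ, ObstacleProblem.IsObstacleSolution γ F f φ Ω u →
      (∃ M : ℝ, ∀ x ∈ Ω, |u x| ≤ M) →
      ∀ x₀ ∈ ObstacleProblem.nonCoincidence Ω φ u ∩ Ω', ∀ r : ℝ,
      r = Metric.infDist x₀ (frontier (ObstacleProblem.nonCoincidence Ω φ u)) →
      ENNReal.ofReal (c * r ^ (1 / (γ + 1)))
          - 2⁻¹ * eLpNorm (gradient φ) ∞ (volume.restrict (Metric.ball x₀ r))
        ≤ ⨆ x ∈ Metric.ball x₀ r, ObstacleProblem.gradLength u x := by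
  have hLam0 : 0 < Lam := hlam.trans_le hLam
  have hn' : (0 : ℝ) < n := Nat.cast_pos.2 hn
  refine ⟨(m / (8 * Lam * n)) ^ (1 / (γ + 1)) / 2, by positivity, ?_⟩
  rintro Ω Ω' - - - - F hF β φ - - - f - hf u hu - x₀ ⟨hx₀, -⟩ r hr
  -- Subtraction in `ℝ≥0∞` is truncated, so the obstacle term can be dropped.
  refine tsub_le_self.trans ?_
  rcases (show 0 ≤ r from hr ▸ Metric.infDist_nonneg).eq_or_lt with h0 | h0
  -- For `r = 0` the left side vanishes, since the exponent is positive.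
  · rw [← h0, Real.zero_rpow (by positivity), mul_zero, ENNReal.ofReal_zero]
    exact zero_le
  · exact hu.solution.2.rpow_le_iSup_gradLength hn hγ hLam0 hm hF (fun x hx => hf x hx.1) h0
      (hr ▸ Metric.ball_infDist_frontier_subset hx₀)
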